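/- There is an absolute constant $C > 0$ such that the following holds. Let $G$ be a finite group with $n = |G| \ge 2$ elements, and let $S = S^{-1} \subseteq G$ be a symmetric subset not containing the identity. Let $\mathrm{Cay}(G,S)$ be the Cayley graph with vertex set $G$ and edges $(g, sg)$ for $g \in G$, $s \in S$. Then the space of functions $G \to \mathbb{R}$ has a basis $x_1, \dots, x_n$ consisting of (real-valued) eigenvectors of the adjacency matrix of $\mathrm{Cay}(G,S)$, which is orthonormal for the averaged inner product, $$\frac1n \sum_{g \in G} x_i(g)\, x_j(g) = \begin{cases} 1 & \text{if } i = j,\\ 0 & \text{if } i \ne j,\end{cases}$$ and which is $C\sqrt{\log n}$-bounded, that is, $\max_{g \in G} |x_i(g)| \le C \sqrt{\log n}$ for every $i$. -/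

import Mathlib

open scoped BigOperators

/-- The Cayley graph on a group `G` with symmetric connection set `S = S⁻¹` not containing the
identity: the edges are the pairs `(g, s * g)` with `g ∈ G` and `s ∈ S`. -/
def cayleyGraph {G : Type*} [Group G] (S : Set G) (hsymm : S⁻¹ = S) (hone : (1 : G) ∉ S) :
    SimpleGraph G where
  Adj g h := ∃ s ∈ S, h = s * g
  symm := ⟨by
    rintro g h ⟨s, hs, rfl⟩
    refine ⟨s⁻¹, ?_, by group⟩
    rw [← hsymm]
    simpa using hs⟩
  loopless := ⟨by
    rintro g ⟨s, hs, h⟩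
    have h1 : s = 1 := by simpa using h
    exact hone (h1 ▸ hs)⟩

/-- The inner product of `x, y : V → ℝ` for the averaging measure on the finite set `V`:
`⟨x, y⟩ = 𝔼 v, x v * y v`. -/
noncomputable def avgInner {V : Type*} [Fintype V] (x y : V → ℝ) : ℝ :=
  𝔼 v, x v * y v

/-- `b` is a (real) orthonormal eigenbasis of the graph `Γ`: a basis of the space of real functions
on the vertex set, orthonormal for the averaged inner product, each member of which is an
eigenvector of the adjacency matrix. -/
structure IsOrthonormalEigenbasis {V ι : Type*} [Fintype V] [DecidableEq ι] (Γ : SimpleGraph V)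
    [DecidableRel Γ.Adj] (b : Module.Basis ι ℝ (V → ℝ)) : Prop where
  orthonormal : ∀ i j, avgInner (b i) (b j) = if i = j then 1 else 0
  eigen : ∀ i, ∃ μ : ℝ, Module.End.HasEigenvector (Γ.adjMatrix ℝ).mulVecLin μ (b i)

/-- A family of functions on a finite set is `C`-bounded if each member has `L^∞` norm at most
`C`; the norm on `V → ℝ` is the supremum norm. -/
def IsBoundedFamily {V ι : Type*} [Fintype V] (C : ℝ) (b : ι → V → ℝ) : Prop :=
  ∀ i, ‖b i‖ ≤ C

/-! Right translations are transitive on `G` and commute with the adjacency operator, so in each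
eigenspace `W`, of dimension `d`, the projections of the `n` point masses all have squared norm `d /
n`. Scaled by `√n`, they represent the values of `√n • w` for `w ∈ W`. It remains to find an
orthonormal basis of `W` in which `n` given vectors of squared norm at most `d` have coordinates
`O(√log n)` (`exists_orthonormalBasis_abs_inner_le`). Put random signs on an arbitrary orthonormal
basis and apply a flat orthogonal matrix: each coordinate becomes a Rademacher sum of variance at
most 2, and a union bound over `d * n ≤ n ^ 2` of them suffices. -/

/-! ### A flat real orthogonal matrix -/

open Finset in
/-- The sum of the `d`-th roots of unity `exp (2πimk/d)` over `k`. -/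
lemma sum_exp_two_pi_mul_div (d : ℕ) (hd : d ≠ 0) (m : ℤ) :
    ∑ k : Fin d, Complex.exp (((2 * Real.pi * m * (k : ℕ) / d : ℝ) : ℂ) * Complex.I) =
      if (d : ℤ) ∣ m then (d : ℂ) else 0 := by
  set ζ : ℂ := Complex.exp (2 * Real.pi * Complex.I / d) with hζ
  have hprim : IsPrimitiveRoot ζ d := Complex.isPrimitiveRoot_exp d hd
  have hterm : ∀ k : Fin d,
      Complex.exp (((2 * Real.pi * m * (k : ℕ) / d : ℝ) : ℂ) * Complex.I) = (ζ ^ m) ^ (k : ℕ) := by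
    intro k
    rw [hζ, ← Complex.exp_int_mul, ← Complex.exp_nat_mul]
    congr 1
    push_cast
    ring
  rw [sum_congr rfl fun k _ => hterm k, Fin.sum_univ_eq_sum_range (fun k => (ζ ^ m) ^ k) d]
  split_ifs with h
  · simp [(hprim.zpow_eq_one_iff_dvd m).2 h]
  · have hne : ζ ^ m ≠ 1 := fun h1 => h ((hprim.zpow_eq_one_iff_dvd m).1 h1)
    have hpow : (ζ ^ m) ^ d = 1 := by
      rw [← zpow_natCast, ← zpow_mul, mul_comm, zpow_mul, zpow_natCast, hprim.pow_eq_one, one_zpow]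
    rw [geom_sum_eq hne, hpow, sub_self, zero_div]

lemma sum_cos_two_pi_mul_div (d : ℕ) (hd : d ≠ 0) (m : ℤ) :
    ∑ k : Fin d, Real.cos (2 * Real.pi * m * (k : ℕ) / d) = if (d : ℤ) ∣ m then (d : ℝ) else 0 := by
  have h := congrArg Complex.re (sum_exp_two_pi_mul_div d hd m)
  rw [Complex.re_sum] at h
  simp only [Complex.exp_ofReal_mul_I_re] at h
  rw [h]
  split_ifs <;> simp

lemma sum_sin_two_pi_mul_div (d : ℕ) (hd : d ≠ 0) (m : ℤ) :
    ∑ k : Fin d, Real.sin (2 * Real.pi * m * (k : ℕ) / d) = 0 := by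
  have h := congrArg Complex.im (sum_exp_two_pi_mul_div d hd m)
  rw [Complex.im_sum] at h
  simp only [Complex.exp_ofReal_mul_I_im] at h
  rw [h]
  split_ifs <;> simp

/-- The orthogonal discrete Hartley transform matrix. -/
noncomputable def hartleyMatrix (d : ℕ) : Matrix (Fin d) (Fin d) ℝ := fun j k =>
  (Real.cos (2 * Real.pi * (j : ℕ) * (k : ℕ) / d) + Real.sin (2 * Real.pi * (j : ℕ) * (k : ℕ) / d)) /
    Real.sqrt d

/-- With `cas = cos + sin`, one has `cas a * cas b = cos (a - b) + sin (a + b)`; only the cosine sum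
with `d ∣ i - j` survives. -/
lemma sum_hartleyMatrix_mul (d : ℕ) (i j : Fin d) :
    ∑ k, hartleyMatrix d i k * hartleyMatrix d j k = if i = j then 1 else 0 := by
  have hd : d ≠ 0 := fun h => (h ▸ i).elim0
  have hd' : (d : ℝ) ≠ 0 := Nat.cast_ne_zero.2 hd
  have hterm : ∀ k : Fin d, hartleyMatrix d i k * hartleyMatrix d j k =
      (Real.cos (2 * Real.pi * (((i : ℕ) - (j : ℕ) : ℤ) : ℝ) * (k : ℕ) / d) +
        Real.sin (2 * Real.pi * (((i : ℕ) + (j : ℕ) : ℤ) : ℝ) * (k : ℕ) / d)) / d := by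
    intro k
    have e1 : 2 * Real.pi * (((i : ℕ) - (j : ℕ) : ℤ) : ℝ) * (k : ℕ) / d =
        2 * Real.pi * (i : ℕ) * (k : ℕ) / d - 2 * Real.pi * (j : ℕ) * (k : ℕ) / d := by
      push_cast; ring
    have e2 : 2 * Real.pi * (((i : ℕ) + (j : ℕ) : ℤ) : ℝ) * (k : ℕ) / d =
        2 * Real.pi * (i : ℕ) * (k : ℕ) / d + 2 * Real.pi * (j : ℕ) * (k : ℕ) / d := by
      push_cast; ring
    rw [e1, e2, Real.cos_sub, Real.sin_add, hartleyMatrix, hartleyMatrix, div_mul_div_comm,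
      Real.mul_self_sqrt d.cast_nonneg]
    ring
  rw [Finset.sum_congr rfl fun k _ => hterm k, ← Finset.sum_div, Finset.sum_add_distrib,
    sum_cos_two_pi_mul_div d hd, sum_sin_two_pi_mul_div d hd]
  have hiff : (d : ℤ) ∣ ((i : ℕ) - (j : ℕ) : ℤ) ↔ i = j := by
    constructor
    · intro h
      have := Int.eq_zero_of_abs_lt_dvd h (by rw [abs_lt]; omega)
      omega
    · rintro rfl
      simp
  simp only [hiff]
  split_ifs <;> simp [hd']

lemma hartleyMatrix_sq_le (d : ℕ) (i j : Fin d) : hartleyMatrix d i j ^ 2 ≤ 2 / d := by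
  rw [hartleyMatrix, div_pow, Real.sq_sqrt d.cast_nonneg]
  gcongr
  nlinarith [Real.sin_sq_add_cos_sq (2 * Real.pi * (i : ℕ) * (j : ℕ) / d),
    sq_nonneg (Real.cos (2 * Real.pi * (i : ℕ) * (j : ℕ) / d) -
      Real.sin (2 * Real.pi * (i : ℕ) * (j : ℕ) / d))]

/-! ### Random signs -/

/-- The moment generating function of a Rademacher sum. -/
lemma sum_signs_exp_le {ι : Type*} [Fintype ι] [DecidableEq ι] (x : ι → ℝ) :
    ∑ ε : ι → ℤˣ, Real.exp (∑ j, ((ε j : ℤ) : ℝ) * x j) ≤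
      2 ^ Fintype.card ι * Real.exp ((∑ j, x j ^ 2) / 2) := by
  have h2 : ∀ j, ∑ s : ℤˣ, Real.exp (((s : ℤ) : ℝ) * x j) = 2 * Real.cosh (x j) := by
    intro j
    rw [UnitsInt.univ, Finset.sum_pair (by decide), Real.cosh_eq]
    simp
    ring
  simp_rw [Real.exp_sum]
  rw [← Fintype.prod_sum (fun j (s : ℤˣ) => Real.exp (((s : ℤ) : ℝ) * x j))]
  simp_rw [h2]
  rw [Finset.prod_mul_distrib, Finset.sum_div, Real.exp_sum]
  simp only [Finset.prod_const, Finset.card_univ]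
  gcongr with j _
  exact Real.cosh_le_exp_half_sq _

/-- Some choice of signs makes finitely many signed sums simultaneously of logarithmic size. -/
lemma exists_signs_exp_abs_le {ι α : Type*} [Fintype ι] [Fintype α] (a : α → ι → ℝ) {v : ℝ}
    (ha : ∀ i, ∑ j, a i j ^ 2 ≤ v) (t : ℝ) :
    ∃ ε : ι → ℤˣ, ∀ i, Real.exp |t * ∑ j, ((ε j : ℤ) : ℝ) * a i j| ≤
      2 * Fintype.card α * Real.exp (t ^ 2 * v / 2) := by
  classical
  have key : ∀ (s : ℝ), s ^ 2 = t ^ 2 → ∀ i,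
      ∑ ε : ι → ℤˣ, Real.exp (s * ∑ j, ((ε j : ℤ) : ℝ) * a i j) ≤
        2 ^ Fintype.card ι * Real.exp (t ^ 2 * v / 2) := by
    intro s hs i
    have h := sum_signs_exp_le fun j => s * a i j
    have e : ∀ ε : ι → ℤˣ, ∑ j, ((ε j : ℤ) : ℝ) * (s * a i j) =
        s * ∑ j, ((ε j : ℤ) : ℝ) * a i j := by
      intro ε
      rw [Finset.mul_sum]
      exact Finset.sum_congr rfl fun j _ => by ring
    simp_rw [e] at h
    refine h.trans ?_
    simp_rw [mul_pow, ← Finset.mul_sum, hs]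
    gcongr
    exact ha i
  -- Union bound by averaging: `exp |y| ≤ exp y + exp (-y)`, and some sign vector does no worse than
  -- the mean.
  have htotal : ∑ ε : ι → ℤˣ, ∑ i, (Real.exp (t * ∑ j, ((ε j : ℤ) : ℝ) * a i j) +
      Real.exp (-t * ∑ j, ((ε j : ℤ) : ℝ) * a i j)) ≤
      ∑ _ε : ι → ℤˣ, 2 * Fintype.card α * Real.exp (t ^ 2 * v / 2) := by
    rw [Finset.sum_comm]
    calc _ ≤ ∑ _i : α, (2 ^ Fintype.card ι * Real.exp (t ^ 2 * v / 2) +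
          2 ^ Fintype.card ι * Real.exp (t ^ 2 * v / 2)) := by
          refine Finset.sum_le_sum fun i _ => ?_
          rw [Finset.sum_add_distrib]
          exact add_le_add (key t rfl i) (key (-t) (by ring) i)
      _ = _ := by
          simp
          ring
  obtain ⟨ε, -, hε⟩ := Finset.exists_le_of_sum_le Finset.univ_nonempty htotal
  refine ⟨ε, fun i => le_trans ?_ hε⟩
  refine le_trans ?_ (Finset.single_le_sum
    (f := fun i => Real.exp (t * ∑ j, ((ε j : ℤ) : ℝ) * a i j) +
      Real.exp (-t * ∑ j, ((ε j : ℤ) : ℝ) * a i j)) (fun i _ => by positivity) (Finset.mem_univ i))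
  rcases abs_choice (t * ∑ j, ((ε j : ℤ) : ℝ) * a i j) with h | h <;> rw [h]
  · exact le_add_of_nonneg_right (Real.exp_pos _).le
  · rw [neg_mul]
    exact le_add_of_nonneg_left (Real.exp_pos _).le

/-- Finitely many vectors of norm at most the square root of the dimension have coordinates of
size `O(√log n)` in a suitable orthonormal basis. -/
lemma exists_orthonormalBasis_abs_inner_le {E α : Type*} [NormedAddCommGroup E]
    [InnerProductSpace ℝ E] [FiniteDimensional ℝ E] [Fintype α] (u : α → E)
    (hu : ∀ a, ‖u a‖ ^ 2 ≤ Module.finrank ℝ E) (hn : 2 ≤ Fintype.card α)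
    (hdim : Module.finrank ℝ E ≤ Fintype.card α) :
    ∃ e : OrthonormalBasis (Fin (Module.finrank ℝ E)) ℝ E,
      ∀ i a, |inner ℝ (e i) (u a)| ≤ 4 * Real.sqrt (Real.log (Fintype.card α)) := by
  set d := Module.finrank ℝ E with hd
  set n := Fintype.card α
  set f := stdOrthonormalBasis ℝ E
  have hlog : 0 < Real.log n := Real.log_pos (by exact_mod_cast hn)
  set t := Real.sqrt (Real.log n) with ht
  have htpos : 0 < t := Real.sqrt_pos.2 hlog
  have htsq : t ^ 2 = Real.log n := Real.sq_sqrt hlog.le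
  obtain ⟨ε, hε⟩ := exists_signs_exp_abs_le (v := 2)
    (fun (p : Fin d × α) j => hartleyMatrix d p.1 j * inner ℝ (f j) (u p.2)) (by
      rintro ⟨i, a⟩
      have hd0 : (d : ℝ) ≠ 0 := Nat.cast_ne_zero.2 fun h => (h ▸ i).elim0
      calc ∑ j, (hartleyMatrix d i j * inner ℝ (f j) (u a)) ^ 2
          ≤ ∑ j, 2 / d * inner ℝ (f j) (u a) ^ 2 := by
            refine Finset.sum_le_sum fun j _ => ?_
            rw [mul_pow]
            exact mul_le_mul_of_nonneg_right (hartleyMatrix_sq_le d i j) (sq_nonneg _)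
        _ = 2 / d * ‖u a‖ ^ 2 := by
            rw [← Finset.mul_sum, ← f.sum_sq_norm_inner_right (u a)]
            simp only [Real.norm_eq_abs, sq_abs]
        _ ≤ 2 / d * d := by gcongr; exact hu a
        _ = 2 := by field_simp) t
  set e₀ : Fin d → E := fun i => ∑ j, (hartleyMatrix d i j * ((ε j : ℤ) : ℝ)) • f j
  -- Sign changes of the columns keep the matrix orthogonal.
  have he₀ : Orthonormal ℝ e₀ := by
    rw [orthonormal_iff_ite]
    intro i i'
    rw [f.orthonormal.inner_sum]
    rw [← sum_hartleyMatrix_mul d i i']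
    refine Finset.sum_congr rfl fun j _ => ?_
    rcases Int.units_eq_one_or (ε j) with h | h <;> simp [h]
  have hcard : Fintype.card (Fin d) = Module.finrank ℝ E := by simp [hd]
  have hspan : ⊤ ≤ Submodule.span ℝ (Set.range e₀) :=
    (he₀.linearIndependent.span_eq_top_of_card_eq_finrank' hcard).ge
  refine ⟨OrthonormalBasis.mk he₀ hspan, fun i a => ?_⟩
  rw [OrthonormalBasis.coe_mk]
  have hinner : inner ℝ (e₀ i) (u a) =
      ∑ j, ((ε j : ℤ) : ℝ) * (hartleyMatrix d i j * inner ℝ (f j) (u a)) := by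
    rw [sum_inner]
    refine Finset.sum_congr rfl fun j _ => ?_
    rw [real_inner_smul_left]
    ring
  have h := hε (i, a)
  simp only at h
  rw [← hinner] at h
  have hn0 : (0 : ℝ) < n := by positivity
  have hn2 : (2 : ℝ) ≤ n := by exact_mod_cast hn
  have hdn : (d : ℝ) ≤ n := by exact_mod_cast hdim
  have hexp : Real.exp (t ^ 2 * 2 / 2) = n := by
    rw [mul_div_cancel_right₀ _ two_ne_zero, htsq, Real.exp_log hn0]
  -- Source of the constant 4: the bound `2 * (d * n) * n` is at most `n ^ 4 = exp (4 * t ^ 2)`.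
  have hle : Real.exp |t * inner ℝ (e₀ i) (u a)| ≤ Real.exp (4 * t ^ 2) := by
    refine h.trans ?_
    rw [hexp, Fintype.card_prod, Fintype.card_fin]
    have h4 : Real.exp (4 * t ^ 2) = (n : ℝ) ^ 4 := by
      rw [htsq, mul_comm, Real.exp_mul, Real.exp_log hn0]
      norm_cast
    rw [h4]
    push_cast
    calc 2 * ((d : ℝ) * n) * n ≤ n * (n * n) * n := by gcongr
      _ = (n : ℝ) ^ 4 := by ring
  rw [Real.exp_le_exp, abs_mul, abs_of_pos htpos] at hle
  nlinarith

/-! ### Transitive symmetry and assembly -/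

/-- A subspace of functions on `V` invariant under a transitive set of permutations has coordinate
projections of equal norm. -/
lemma card_mul_norm_orthogonalProjectionOnto_sq {V : Type*} [Fintype V] [DecidableEq V]
    (W : Submodule ℝ (EuclideanSpace ℝ V))
    (hW : ∀ v w : V, ∃ σ : V ≃ V, σ v = w ∧
      ∀ x ∈ W, LinearIsometryEquiv.piLpCongrLeft 2 ℝ ℝ σ x ∈ W) (v : V) :
    Fintype.card V * ‖W.orthogonalProjectionOnto (EuclideanSpace.single v (1 : ℝ))‖ ^ 2 =
      Module.finrank ℝ W := by
  set p : V → W := fun v => W.orthogonalProjectionOnto (EuclideanSpace.single v (1 : ℝ)) with hp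
  -- `p w` is the reproducing kernel of `W` at `w`.
  have hinner : ∀ (x : W) (w : V), inner ℝ x (p w) = (x : EuclideanSpace ℝ V) w := by
    intro x w
    rw [hp, Submodule.inner_orthogonalProjectionOnto_eq_of_mem_left, EuclideanSpace.inner_single_right]
    simp
  -- The translate `q` of `p v` takes the value `‖p v‖ ^ 2` at `σ v`; apply Cauchy–Schwarz against
  -- `p (σ v)`.
  have hle : ∀ v w, ‖p v‖ ≤ ‖p w‖ := by
    intro v w
    obtain ⟨σ, rfl, hσ⟩ := hW v w
    set q : W := ⟨LinearIsometryEquiv.piLpCongrLeft 2 ℝ ℝ σ (p v), hσ _ (p v).2⟩ with hq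
    have hnorm : ‖q‖ = ‖p v‖ := by
      rw [← Submodule.norm_coe, hq, LinearIsometryEquiv.norm_map, Submodule.norm_coe]
    have h1 : inner ℝ q (p (σ v)) = inner ℝ (p v) (p v) := by
      rw [hinner, hinner, hq]
      simp [LinearIsometryEquiv.piLpCongrLeft_apply, Equiv.piCongrLeft'_apply]
    have h2 := real_inner_le_norm q (p (σ v))
    rw [h1, real_inner_self_eq_norm_sq, hnorm] at h2
    rcases (norm_nonneg (p v)).eq_or_lt with h0 | h0
    · rw [← h0]; exact norm_nonneg _
    · nlinarith
  have hconst : ∀ w, ‖p w‖ = ‖p v‖ := fun w => le_antisymm (hle w v) (hle v w)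
  set f := stdOrthonormalBasis ℝ W
  have hsum : ∑ w, ‖p w‖ ^ 2 = Module.finrank ℝ W := by
    simp_rw [← f.sum_sq_norm_inner_right, hinner]
    rw [Finset.sum_comm]
    simp_rw [← EuclideanSpace.norm_sq_eq, Submodule.norm_coe, f.norm_eq_one]
    simp
  rw [← hsum, Finset.sum_congr rfl fun w _ => by rw [hconst w], Finset.sum_const, nsmul_eq_mul,
    Finset.card_univ]

/-- Edges come from left multiplication, which commutes with right multiplication. -/
lemma adjMatrix_cayleyGraph_mulVec_mul_right {G : Type*} [Group G] [Fintype G] (S : Set G)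
    (hsymm : S⁻¹ = S) (hone : (1 : G) ∉ S) [DecidableRel (cayleyGraph S hsymm hone).Adj]
    (x : G → ℝ) (h g : G) :
    (((cayleyGraph S hsymm hone).adjMatrix ℝ).mulVec fun g => x (g * h)) g =
      (((cayleyGraph S hsymm hone).adjMatrix ℝ).mulVec x) (g * h) := by
  simp only [Matrix.mulVec, dotProduct]
  refine Fintype.sum_equiv (Equiv.mulRight h) _ _ fun k => ?_
  have hadj : (cayleyGraph S hsymm hone).Adj (g * h) (k * h) ↔
      (cayleyGraph S hsymm hone).Adj g k := by
    simp [cayleyGraph, ← mul_assoc]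
  simp [SimpleGraph.adjMatrix_apply, hadj]

theorem theorem1p3 :
    ∃ C : ℝ, 0 < C ∧
      ∀ (G : Type*) [Group G] [Fintype G] (S : Set G) (hsymm : S⁻¹ = S) (hone : (1 : G) ∉ S)
        [DecidableRel (cayleyGraph S hsymm hone).Adj],
        2 ≤ Fintype.card G →
          ∃ b : Module.Basis (Fin (Fintype.card G)) ℝ (G → ℝ),
            IsOrthonormalEigenbasis (cayleyGraph S hsymm hone) b ∧
              IsBoundedFamily (C * Real.sqrt (Real.log (Fintype.card G))) b := by
  classical
  refine ⟨4, by norm_num, ?_⟩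
  intro G _ _ S hsymm hone _ hcard
  set n := Fintype.card G with hn
  set A := (cayleyGraph S hsymm hone).adjMatrix ℝ with hA
  set T := Matrix.toEuclideanLin A with hTdef
  have hT : T.IsSymmetric :=
    Matrix.isSymmetric_toEuclideanLin_iff.mpr ((cayleyGraph S hsymm hone).isHermitian_adjMatrix ℝ)
  have hn0 : (0 : ℝ) < n := by positivity
  set r := Real.sqrt n with hr
  have hr0 : 0 < r := Real.sqrt_pos.2 hn0
  have hrsq : r ^ 2 = n := Real.sq_sqrt hn0.le
  have hinv : ∀ (μ : ℝ) (v w : G), ∃ σ : G ≃ G, σ v = w ∧ ∀ x ∈ Module.End.eigenspace T μ,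
      LinearIsometryEquiv.piLpCongrLeft 2 ℝ ℝ σ x ∈ Module.End.eigenspace T μ := by
    intro μ v w
    refine ⟨Equiv.mulRight (v⁻¹ * w), by simp, fun x hx => ?_⟩
    rw [Module.End.mem_eigenspace_iff] at hx ⊢
    have hx' : ∀ g, (A.mulVec x.ofLp) g = μ * x g := fun g => by
      have := congrArg (fun y : EuclideanSpace ℝ G => y g) hx
      simpa [hTdef] using this
    ext g
    have hy : (LinearIsometryEquiv.piLpCongrLeft 2 ℝ ℝ (Equiv.mulRight (v⁻¹ * w)) x).ofLp =
        fun g => x (g * (v⁻¹ * w)⁻¹) := by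
      rfl
    have := adjMatrix_cayleyGraph_mulVec_mul_right S hsymm hone x.ofLp (v⁻¹ * w)⁻¹ g
    rw [← hA, hx'] at this
    rw [hTdef, Matrix.toLpLin_apply, PiLp.smul_apply, hy]
    simpa using this
  have hbases : ∀ μ : Module.End.Eigenvalues T,
      ∃ e : OrthonormalBasis (Fin (Module.finrank ℝ (Module.End.eigenspace T μ))) ℝ
        (Module.End.eigenspace T μ), ∀ i g,
          |r * (e i : EuclideanSpace ℝ G) g| ≤ 4 * Real.sqrt (Real.log n) := by
    intro μ
    set W := Module.End.eigenspace T (μ : ℝ)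
    obtain ⟨e, he⟩ := exists_orthonormalBasis_abs_inner_le
      (fun g : G => r • W.orthogonalProjectionOnto (EuclideanSpace.single g (1 : ℝ)))
      (fun g => by
        rw [norm_smul, mul_pow, Real.norm_of_nonneg hr0.le, hrsq,
          card_mul_norm_orthogonalProjectionOnto_sq W (hinv μ) g])
      hcard (by simpa using W.finrank_le)
    refine ⟨e, fun i g => ?_⟩
    have h := he i g
    rw [real_inner_smul_right, Submodule.inner_orthogonalProjectionOnto_eq_of_mem_left,
      EuclideanSpace.inner_single_right] at h
    simpa [abs_mul] using h
  choose e he using hbases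
  set b₀ := hT.direct_sum_isInternal.collectedOrthonormalBasis hT.orthogonalFamily_eigenspaces' e
    with hb₀
  have hb₀_apply : ∀ a, b₀ a = (e a.1 a.2 : EuclideanSpace ℝ G) := by
    intro a
    simp [hb₀, DirectSum.IsInternal.collectedOrthonormalBasis]
  have hcard' : Fintype.card (Σ μ : Module.End.Eigenvalues T,
      Fin (Module.finrank ℝ (Module.End.eigenspace T μ))) = n := by
    rw [← Module.finrank_eq_card_basis b₀.toBasis, finrank_euclideanSpace]
  set b₁ := b₀.reindex (Fintype.equivFinOfCardEq hcard') with hb₁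
  have hunit : ∀ _i : Fin n, IsUnit r := fun _ => hr0.ne'.isUnit
  -- The factor `r = √n` converts Euclidean orthonormality to the averaged one.
  refine ⟨(b₁.toBasis.map (WithLp.linearEquiv 2 ℝ (G → ℝ))).isUnitSMul hunit, ⟨?_, ?_⟩, ?_⟩
  · intro i j
    have horth := orthonormal_iff_ite.1 b₁.orthonormal j i
    rw [PiLp.inner_apply] at horth
    simp only [RCLike.inner_apply, conj_trivial] at horth
    rw [avgInner, Fintype.expect_eq_sum_div_card]
    simp only [Module.Basis.isUnitSMul_apply, Module.Basis.map_apply, OrthonormalBasis.coe_toBasis,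
      Pi.smul_apply, smul_eq_mul, WithLp.linearEquiv_apply]
    have hmul : ∀ g, r * (b₁ i) g * (r * (b₁ j) g) = n * ((b₁ i) g * (b₁ j) g) := by
      intro g
      rw [← hrsq]
      ring
    change (∑ g, r * (b₁ i) g * (r * (b₁ j) g)) / (n : ℝ) = _
    simp_rw [hmul]
    rw [← Finset.mul_sum, horth, mul_div_cancel_left₀ _ hn0.ne']
    simp only [eq_comm]
  · intro i
    set a := (Fintype.equivFinOfCardEq hcard').symm i with ha
    refine ⟨a.1, ?_, Module.Basis.ne_zero _ i⟩
    have hmem : b₁ i ∈ Module.End.eigenspace T (a.1 : ℝ) := by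
      rw [hb₁, OrthonormalBasis.reindex_apply, hb₀_apply]
      exact (e a.1 a.2).2
    rw [Module.End.mem_eigenspace_iff] at hmem ⊢
    rw [Module.Basis.isUnitSMul_apply, map_smul, smul_comm]
    congr 1
    exact congrArg WithLp.ofLp hmem
  · intro i
    rw [pi_norm_le_iff_of_nonneg (by positivity)]
    intro g
    have h := he _ ((Fintype.equivFinOfCardEq hcard').symm i).2 g
    rw [← hb₀_apply] at h
    simpa [hb₁, Module.Basis.isUnitSMul_apply] using h
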